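/- All vector spaces, linear maps and algebras are over a field $\mathbb F$ of characteristic $0$; a differential algebra $(A,\partial)$ is a commutative, associative, unital $\mathbb F$-algebra $A$ with a derivation $\partial$. For $p(\lambda)=\sum_n\lambda^n p_n$ write $p(\lambda+x)\big(\big|_{x=\partial}b\big)=\sum_n p_n(\lambda+\partial)^n(b)$ and $\big(\big|_{x=\partial}p(-\lambda-x)\big)=\sum_n(-\lambda-\partial)^n(p_n)$. A *$\lambda$-bracket* on a vector space $V$ is a bilinear map $V\times V\to V[\lambda]$. A *Lie conformal algebra* is an $\mathbb F[\partial]$-module with a $\lambda$-bracket $[\cdot_\lambda\cdot]$ satisfying sesquilinearity, $[\partial u_\lambda v]=-\lambda[u_\lambda v]$ and $[u_\lambda\partial v]=(\partial+\lambda)[u_\lambda v]$, skewsymmetry, $[v_\lambda u]=-\big(\big|_{x=\partial}[u_{-\lambda-x}v]\big)$, and the Jacobi identity, $[u_\lambda[v_\mu w]]-[v_\mu[u_\lambda w]]=[[u_\lambda v]_{\lambda+\mu}w]$. A *Poisson vertex algebra* (PVA) is a differential algebra $V$ with a Lie conformal algebra $\lambda$-bracket $\{\cdot_\lambda\cdot\}$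 satisfying the (left) Leibniz rule $\{f_\lambda gh\}=g\{f_\lambda h\}+h\{f_\lambda g\}$. Let $\mathrm{CDer}(A)$ be the space of linear maps $\phi_\lambda:A\to A[\lambda]$ with $\phi_\lambda(\partial a)=(\partial+\lambda)\phi_\lambda(a)$ and $\phi_\lambda(ab)=b\,\phi_\lambda(a)+a\,\phi_\lambda(b)$, with the $A[\partial]$-module structure $(a\phi)_\lambda(b)=\phi_{\lambda+x}(b)\big(\big|_{x=\partial}a\big)$, $(\partial\phi)_\lambda=-\lambda\phi_\lambda$. For $\phi\in\mathrm{CDer}(A)$ put $\phi^*_\lambda(a)=\big(\big|_{x=\partial}\phi_{-\lambda-x}(a)\big)$. A *Lie conformal algebroid* (LCAd) $E$ over $A$ is a left $A[\partial]$-module with a Lie conformal algebra $\lambda$-bracket $[\cdot_\lambda\cdot]$ and a homomorphism of left $A[\partial]$-modules $\theta:E\to\mathrm{CDer}(A)$ such that, for $u,v\in E$ and $a\in A$, $$[u_\lambda av]=\theta(u)_\lambda(a)\,v+a[u_\lambda v],\qquad \theta([u_\lambda v])_\mu(a)=\theta(u)_\lambda(\theta(v)_{\mu-\lambda}(a))-\theta(v)_{\mu-\lambda}(\theta(u)_\lambda(a)).$$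 **Theorem.** Let $E$ be an LCAd over the differential algebra $A$, and let the symmetric algebra $S_A(E)$ of the $A$-module $E$ be equipped with the unique derivation $\partial$ extending $\partial$ on $A$ and on $E$. Then there is a unique $\lambda$-bracket $\{\cdot_\lambda\cdot\}$ on $S_A(E)$ that satisfies, for all $f,g,h\in S_A(E)$, the left and the right Leibniz rules $$\{f_\lambda gh\}=g\{f_\lambda h\}+h\{f_\lambda g\},\qquad \{fg_\lambda h\}=\{f_{\lambda+x}h\}\big(\big|_{x=\partial}g\big)+\{g_{\lambda+x}h\}\big(\big|_{x=\partial}f\big),$$ and has, for all $a,b\in A$ and $u,v\in E$, the values $$\{a_\lambda b\}=0,\quad \{u_\lambda a\}=\theta(u)_\lambda(a),\quad \{a_\lambda u\}=-\theta(u)^*_\lambda(a),\quad \{u_\lambda v\}=[u_\lambda v].$$ With this $\lambda$-bracket, $S_A(E)$ is a PVA. -/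

import Mathlib

/-!
Lambda-brackets, Lie conformal algebras, conformal derivations, Lie conformal algebroids,
Poisson vertex algebras, and the differential algebra structure on the symmetric algebra of a
differential module.
-/

/-- Polynomials in one indeterminate `λ` with coefficients in `M`; `p n` is the coefficient of
`λ ^ n`. Polynomials in two indeterminates `λ`, `μ` are `LPoly (LPoly M)`, where the inner
indeterminate is `λ` and the outer one is `μ`.
(The pointwise product of finitely supported functions is never used.) -/
abbrev LPoly (M : Type*) [Zero M] : Type _ := ℕ →₀ M

namespace LPoly

section Ops

variable (F : Type*) [Field F] {M N : Type*} [AddCommGroup M] [Module F M]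
  [AddCommGroup N] [Module F N]

/-- Constant polynomials. -/
noncomputable def const : M →ₗ[F] LPoly M := Finsupp.lsingle 0

/-- Multiplication by the indeterminate. -/
noncomputable def lam : LPoly M →ₗ[F] LPoly M := Finsupp.lmapDomain M F Nat.succ

variable {F}

/-- Apply a linear map to every coefficient. -/
noncomputable def map (f : M →ₗ[F] N) : LPoly M →ₗ[F] LPoly N := Finsupp.mapRange.linearMap f

/-- Substitution of an endomorphism `T` of `N` for the indeterminate, after applying `f` to the
coefficients: `∑ λ ^ n m_n ↦ ∑ T ^ n (f m_n)`. -/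
noncomputable def subst (f : M →ₗ[F] N) (T : Module.End F N) : LPoly M →ₗ[F] N :=
  Finsupp.lsum F fun n => (T ^ n) ∘ₗ f

/-- The operator `λ + ∂` on `M[λ]`. -/
noncomputable def lamAdd (d : M →ₗ[F] M) : Module.End F (LPoly M) := lam F + map d

/-- `p(λ) ↦ (|_{x = ∂} p(-λ-x))`, i.e. `∑ λ ^ n m_n ↦ ∑ (-λ-∂) ^ n m_n`. -/
noncomputable def adj (d : M →ₗ[F] M) : LPoly M →ₗ[F] LPoly M :=
  subst (const F) (-lamAdd d)

variable (F M) in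
/-- Multiplication by `λ` on `M[λ][μ]`. -/
noncomputable def lam₁ : Module.End F (LPoly (LPoly M)) := map (lam F)

variable (F M) in
/-- Multiplication by `μ` on `M[λ][μ]`. -/
noncomputable def lam₂ : Module.End F (LPoly (LPoly M)) := lam F

variable (F) in
/-- Constants in `M[λ][μ]`. -/
noncomputable def const₂ : M →ₗ[F] LPoly (LPoly M) := const F ∘ₗ const F

end Ops

section Alg

variable {F A M : Type*} [Field F] [CommRing A] [Algebra F A] [AddCommGroup M] [Module F M]
  [Module A M] [IsScalarTower F A M]

/-- `p(λ) v` for `p ∈ A[λ]` and `v ∈ M`. -/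
noncomputable def smulRight (p : LPoly A) (v : M) : LPoly M :=
  map ((LinearMap.toSpanSingleton A M v).restrictScalars F) p

/-- `p(λ+x)(|_{x = ∂} b)` for `p ∈ A[λ]` and `b ∈ A`, i.e. `∑ p_n (λ+∂) ^ n b`. -/
noncomputable def arrow (d : A →ₗ[F] A) (p : LPoly A) (b : A) : LPoly A :=
  p.sum fun n c => c • ((lamAdd d ^ n) (const F b))

end Alg

end LPoly

open LPoly in
/-- A bilinear map `M × M → M[λ]`. -/
abbrev LambdaBracket (F M : Type*) [Field F] [AddCommGroup M] [Module F M] : Type _ :=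
  M →ₗ[F] M →ₗ[F] LPoly M

open LPoly in
/-- `B` is a Lie conformal algebra bracket on the `F[∂]`-module `M`, where `∂` acts as `d`. -/
structure IsLieConformal {F M : Type*} [Field F] [AddCommGroup M] [Module F M]
    (d : M →ₗ[F] M) (B : LambdaBracket F M) : Prop where
  /-- `[∂u_λ v] = -λ [u_λ v]`. -/
  sesq_left : ∀ u v, B (d u) v = -lam F (B u v)
  /-- `[u_λ ∂v] = (∂ + λ) [u_λ v]`. -/
  sesq_right : ∀ u v, B u (d v) = lamAdd d (B u v)
  /-- `[v_λ u] = -(|_{x = ∂} [u_{-λ-x} v])`. -/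
  skew : ∀ u v, B v u = -adj d (B u v)
  /-- `[u_λ [v_μ w]] - [v_μ [u_λ w]] = [[u_λ v]_{λ+μ} w]` in `M[λ][μ]`. -/
  jacobi : ∀ u v w,
    map (B u) (B v w) - subst (map (const F : M →ₗ[F] LPoly M) ∘ₗ B v) (lam₁ F M) (B u w)
      = subst (subst (const₂ F) (lam₁ F M + lam₂ F M) ∘ₗ B.flip w) (lam₁ F M) (B u v)

section CDer

variable {F A : Type*} [Field F] [CommRing A] [Algebra F A]

open LPoly in
/-- The space of (left) conformal derivations `φ_λ : A → A[λ]` of the differential algebra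
`(A, ∂)`: `φ_λ(∂a) = (∂ + λ) φ_λ(a)` and `φ_λ(ab) = b φ_λ(a) + a φ_λ(b)`. -/
def CDer (d : Derivation F A A) : Submodule F (A →ₗ[F] LPoly A) where
  carrier := {φ | (∀ a, φ (d a) = lamAdd d.toLinearMap (φ a)) ∧
    ∀ a b, φ (a * b) = b • φ a + a • φ b}
  add_mem' := by
    rintro φ ψ ⟨h1, h2⟩ ⟨h3, h4⟩
    refine ⟨fun a => by simp [h1, h3], fun a b => ?_⟩
    simp only [LinearMap.add_apply, h2, h4, smul_add]
    abel
  zero_mem' := by constructor <;> simp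
  smul_mem' := by
    rintro c φ ⟨h1, h2⟩
    refine ⟨fun a => by simp [h1], fun a b => ?_⟩
    simp only [LinearMap.smul_apply, h2, smul_add, smul_comm c]

end CDer

/-- A left `A[∂]`-module structure on the `A`-module `E`, where `(A, dA)` is a differential
algebra: an operator `∂` on `E` with `∂(a u) = (∂a) u + a (∂u)`. -/
structure DiffModule {F A : Type*} [Field F] [CommRing A] [Algebra F A] (dA : Derivation F A A)
    (E : Type*) [AddCommGroup E] [Module F E] [Module A E] where
  /-- The action of `∂` on `E`. -/
  der : E →ₗ[F] E
  der_smul : ∀ (a : A) (u : E), der (a • u) = dA a • u + a • der u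

open LPoly in
/-- A Lie conformal algebroid `E` over the differential algebra `(A, dA)`. -/
structure LieConformalAlgebroid {F A : Type*} [Field F] [CommRing A] [Algebra F A]
    (dA : Derivation F A A) (E : Type*) [AddCommGroup E] [Module F E] [Module A E]
    [IsScalarTower F A E] extends DiffModule dA E where
  /-- The lambda-bracket of `E`. -/
  bracket : LambdaBracket F E
  isLieConformal : IsLieConformal der bracket
  /-- The anchor map `θ : E → CDer(A)`. -/
  anchor : E →ₗ[F] CDer dA
  /-- `θ(a u)_λ(b) = (a θ(u))_λ(b) = (|_{x = ∂} a) θ(u)_{λ+x}(b)`. -/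
  anchor_smul : ∀ (a : A) (u : E) (b : A),
    (anchor (a • u)).1 b = arrow dA.toLinearMap ((anchor u).1 b) a
  /-- `θ(∂u)_λ(b) = (∂θ(u))_λ(b) = -λ θ(u)_λ(b)`. -/
  anchor_der : ∀ (u : E) (b : A), (anchor (der u)).1 b = -lam F ((anchor u).1 b)
  /-- `[u_λ a v] = θ(u)_λ(a) v + a [u_λ v]`. -/
  bracket_smul : ∀ (u : E) (a : A) (v : E),
    bracket u (a • v) = smulRight (F := F) ((anchor u).1 a) v + a • bracket u v
  /-- `θ([u_λ v])_μ(a) = θ(u)_λ(θ(v)_{μ-λ}(a)) - θ(v)_{μ-λ}(θ(u)_λ(a))` in `A[λ][μ]`. -/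
  anchor_bracket : ∀ (u v : E) (a : A),
    subst (map (const F : A →ₗ[F] LPoly A) ∘ₗ LinearMap.flip ((CDer dA).subtype ∘ₗ anchor) a) (lam₁ F A) (bracket u v)
      = subst (const F ∘ₗ (anchor u).1) (lam₂ F A - lam₁ F A) ((anchor v).1 a)
        - subst (subst (const₂ F) (lam₂ F A - lam₁ F A) ∘ₗ (anchor v).1) (lam₁ F A) ((anchor u).1 a)

section PVA

variable {F V : Type*} [Field F] [CommRing V] [Algebra F V]

/-- The left Leibniz rule `{f_λ gh} = g {f_λ h} + h {f_λ g}`. -/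
def LeftLeibniz (B : LambdaBracket F V) : Prop :=
  ∀ f g h : V, B f (g * h) = g • B f h + h • B f g

open LPoly in
/-- The right Leibniz rule `{fg_λ h} = {f_{λ+x} h}(|_{x = ∂} g) + {g_{λ+x} h}(|_{x = ∂} f)`. -/
def RightLeibniz (d : Derivation F V V) (B : LambdaBracket F V) : Prop :=
  ∀ f g h : V, B (f * g) h = arrow d.toLinearMap (B f h) g + arrow d.toLinearMap (B g h) f

/-- The differential algebra `(V, d)` with the lambda-bracket `B` is a Poisson vertex algebra. -/
structure IsPoissonVertexAlgebra (d : Derivation F V V) (B : LambdaBracket F V) : Prop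
    extends IsLieConformal d.toLinearMap B where
  leftLeibniz : LeftLeibniz B

end PVA

namespace DiffModule

section Sym

variable {F A E : Type*} [Field F] [CommRing A] [Algebra F A] {dA : Derivation F A A}
  [AddCommGroup E] [Module F E] [Module A E]

/-- The dual numbers over the symmetric algebra, with the `A`-algebra structure given by
`a ↦ a + (∂a) ε`; used to construct the derivation of the symmetric algebra. -/
def Jet (_ : Derivation F A A) (E : Type*) [AddCommGroup E] [Module A E] : Type _ :=
  TrivSqZeroExt (SymmetricAlgebra A E) (SymmetricAlgebra A E)

noncomputable instance : CommRing (Jet dA E) :=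
  inferInstanceAs (CommRing (TrivSqZeroExt (SymmetricAlgebra A E) (SymmetricAlgebra A E)))

/-- The ring homomorphism `a ↦ a + (∂a) ε`. -/
noncomputable def jetHom (dA : Derivation F A A) (E : Type*) [AddCommGroup E] [Module A E] :
    A →+* Jet dA E where
  toFun a := ((algebraMap A (SymmetricAlgebra A E) a, algebraMap A (SymmetricAlgebra A E) (dA a)) :
    TrivSqZeroExt (SymmetricAlgebra A E) (SymmetricAlgebra A E))
  map_one' := by
    apply TrivSqZeroExt.ext
    · exact map_one _
    · change algebraMap A (SymmetricAlgebra A E) (dA 1) = 0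
      simp
  map_zero' := by
    apply TrivSqZeroExt.ext
    · exact map_zero _
    · change algebraMap A (SymmetricAlgebra A E) (dA 0) = 0
      simp
  map_add' a b := by
    apply TrivSqZeroExt.ext
    · exact map_add _ _ _
    · change algebraMap A (SymmetricAlgebra A E) (dA (a + b)) = _ + _
      rw [map_add, map_add]
  map_mul' a b := by
    apply TrivSqZeroExt.ext
    · exact map_mul _ _ _
    · change algebraMap A (SymmetricAlgebra A E) (dA (a * b)) =
        algebraMap A _ a * algebraMap A _ (dA b) + algebraMap A _ (dA a) * algebraMap A _ b
      rw [Derivation.leibniz, map_add, smul_eq_mul, smul_eq_mul, map_mul, map_mul]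
      ring

noncomputable instance : Algebra A (Jet dA E) := (jetHom dA E).toAlgebra

/-- `u ↦ u + (∂u) ε`. -/
noncomputable def jetLin (D : DiffModule dA E) : E →ₗ[A] Jet dA E where
  toFun u := ((SymmetricAlgebra.ι A E u, SymmetricAlgebra.ι A E (D.der u)) :
    TrivSqZeroExt (SymmetricAlgebra A E) (SymmetricAlgebra A E))
  map_add' u v := by
    apply TrivSqZeroExt.ext
    · exact map_add _ _ _
    · change SymmetricAlgebra.ι A E (D.der (u + v)) = _ + _
      rw [map_add, map_add]
  map_smul' a u := by
    rw [RingHom.id_apply]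
    refine Eq.trans ?_ (Algebra.smul_def (A := Jet dA E) a _).symm
    apply TrivSqZeroExt.ext
    · change SymmetricAlgebra.ι A E (a • u) = algebraMap A _ a * SymmetricAlgebra.ι A E u
      rw [map_smul, Algebra.smul_def]
    · change SymmetricAlgebra.ι A E (D.der (a • u)) =
        algebraMap A _ a * SymmetricAlgebra.ι A E (D.der u)
          + algebraMap A _ (dA a) * SymmetricAlgebra.ι A E u
      rw [D.der_smul, map_add, map_smul, map_smul, Algebra.smul_def, Algebra.smul_def, add_comm]

/-- The first component of an element of the dual numbers. -/
def jetFst : Jet dA E → SymmetricAlgebra A E := TrivSqZeroExt.fst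

/-- The second component of an element of the dual numbers. -/
def jetSnd : Jet dA E → SymmetricAlgebra A E := TrivSqZeroExt.snd

theorem jetFst_lift (D : DiffModule dA E) (f : SymmetricAlgebra A E) :
    jetFst (SymmetricAlgebra.lift D.jetLin f) = f := by
  induction f using SymmetricAlgebra.induction with
  | algebraMap a => rw [AlgHom.commutes]; rfl
  | ι u => rw [SymmetricAlgebra.lift_ι_apply]; rfl
  | mul f g hf hg =>
    rw [map_mul]
    exact (TrivSqZeroExt.fst_mul _ _).trans (congrArg₂ _ hf hg)
  | add f g hf hg =>
    rw [map_add]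
    exact (TrivSqZeroExt.fst_add _ _).trans (congrArg₂ _ hf hg)

theorem jetSnd_algebraMap (D : DiffModule dA E) (a : A) :
    jetSnd (SymmetricAlgebra.lift D.jetLin (algebraMap A _ a)) = algebraMap A _ (dA a) := by
  rw [AlgHom.commutes]; rfl

theorem jetSnd_mul (D : DiffModule dA E) (f g : SymmetricAlgebra A E) :
    jetSnd (SymmetricAlgebra.lift D.jetLin (f * g)) =
      f * jetSnd (SymmetricAlgebra.lift D.jetLin g)
        + g * jetSnd (SymmetricAlgebra.lift D.jetLin f) := by
  rw [map_mul]
  refine (TrivSqZeroExt.snd_mul _ _).trans ?_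
  have hf := D.jetFst_lift f
  have hg := D.jetFst_lift g
  unfold jetFst at hf hg
  rw [hf, hg, op_smul_eq_smul]
  rfl

variable [IsScalarTower F A E]

/-- The derivation `∂` of the symmetric algebra `S_A(E)` that extends `∂` on `A` and on `E`. -/
noncomputable def symDer (D : DiffModule dA E) :
    Derivation F (SymmetricAlgebra A E) (SymmetricAlgebra A E) :=
  Derivation.mk'
    { toFun := fun f => jetSnd (SymmetricAlgebra.lift D.jetLin f)
      map_add' := fun f g => by
        rw [map_add]
        exact TrivSqZeroExt.snd_add _ _
      map_smul' := fun c f => by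
        rw [Algebra.smul_def, jetSnd_mul, IsScalarTower.algebraMap_apply F A,
          jetSnd_algebraMap, Derivation.map_algebraMap, map_zero, mul_zero, add_zero,
          ← IsScalarTower.algebraMap_apply, RingHom.id_apply, Algebra.smul_def] }
    (fun f g => D.jetSnd_mul f g)

theorem symDer_algebraMap (D : DiffModule dA E) (a : A) :
    D.symDer (algebraMap A _ a) = algebraMap A _ (dA a) := D.jetSnd_algebraMap a

theorem symDer_ι (D : DiffModule dA E) (u : E) :
    D.symDer (SymmetricAlgebra.ι A E u) = SymmetricAlgebra.ι A E (D.der u) := by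
  change jetSnd (SymmetricAlgebra.lift D.jetLin _) = _
  rw [SymmetricAlgebra.lift_ι_apply]; rfl

theorem symDer_unique (D : DiffModule dA E)
    (d : Derivation F (SymmetricAlgebra A E) (SymmetricAlgebra A E))
    (hA : ∀ a : A, d (algebraMap A _ a) = algebraMap A _ (dA a))
    (hE : ∀ u : E, d (SymmetricAlgebra.ι A E u) = SymmetricAlgebra.ι A E (D.der u)) :
    d = D.symDer := by
  ext f
  induction f using SymmetricAlgebra.induction with
  | algebraMap a => rw [hA, symDer_algebraMap]
  | ι u => rw [hE, symDer_ι]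
  | mul f g hf hg => rw [Derivation.leibniz, Derivation.leibniz, hf, hg]
  | add f g hf hg => rw [map_add, map_add, hf, hg]

end Sym

end DiffModule

namespace LieConformalAlgebroid

variable {F A E : Type*} [Field F] [CommRing A] [Algebra F A] {dA : Derivation F A A}
  [AddCommGroup E] [Module F E] [Module A E] [IsScalarTower F A E]

open LPoly in
/-- The lambda-bracket `B` on `S_A(E)` has the prescribed values on `A` and `E`. -/
structure ExtendsTo (L : LieConformalAlgebroid dA E)
    (B : LambdaBracket F (SymmetricAlgebra A E)) : Prop where
  /-- `{a_λ b} = 0`. -/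
  base_base : ∀ a b : A, B (algebraMap A _ a) (algebraMap A _ b) = 0
  /-- `{u_λ a} = θ(u)_λ(a)`. -/
  module_base : ∀ (u : E) (a : A), B (SymmetricAlgebra.ι A E u) (algebraMap A _ a)
    = map ((Algebra.linearMap A (SymmetricAlgebra A E)).restrictScalars F) ((L.anchor u).1 a)
  /-- `{a_λ u} = -θ(u)^*_λ(a)`, where `θ(u)^*_λ(a) = (|_{x = ∂} θ(u)_{-λ-x}(a))`. -/
  base_module : ∀ (a : A) (u : E), B (algebraMap A _ a) (SymmetricAlgebra.ι A E u)
    = -map ((Algebra.linearMap A (SymmetricAlgebra A E)).restrictScalars F)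
        (adj dA.toLinearMap ((L.anchor u).1 a))
  /-- `{u_λ v} = [u_λ v]`. -/
  module_module : ∀ u v : E, B (SymmetricAlgebra.ι A E u) (SymmetricAlgebra.ι A E v)
    = map ((SymmetricAlgebra.ι A E).restrictScalars F) (L.bracket u v)

end LieConformalAlgebroid

/-! The substitution `adj`, which puts −λ−∂ for λ, is an involution that exchanges multiplication by
g with p ↦ p(λ+x)(|_{x=∂} g) (`adj_smul`). Hence the right Leibniz rule says exactly that f ↦
{f_{-λ-∂} ·} is a derivation. The bracket is therefore built by extending derivations from A and E
to S_A(E) twice (`exists_derivation`): in the second argument for fixed a ∈ A or u ∈ E, then in the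
first with values in Hom(S, S[λ]). The LCAd axioms are what makes the data on A and E compatible
(`baseDer_mul`, `moduleDer_smul`).

The two Leibniz rules reduce everything to generators, which gives uniqueness (`bracket_ext`). The
opposite bracket −{g_{-λ-∂} f} obeys the same rules and has the same values, so uniqueness gives
skewsymmetry. Sesquilinearity is checked on generators.

For Jacobi, let J(f,g,k) be the difference of the two sides. It is a derivation in k
(`jacobiator_mul`), and skewsymmetry with sesquilinearity relates its values under all permutations
of f, g, k (`jacobiator_swap`, `jacobiator_rotate`). So its vanishing need only be checked on
generators, where it is the Jacobi identity of E, the anchor identity, or trivial. -/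

namespace LPoly

/-! ### Substitutions in polynomials in one and two indeterminates. -/

section Calculus

variable {F M N P : Type*} [Field F] [AddCommGroup M] [Module F M]
  [AddCommGroup N] [Module F N] [AddCommGroup P] [Module F P]

theorem lam_single (n : ℕ) (m : M) :
    lam F (Finsupp.single n m) = Finsupp.single (n + 1) m := by
  simp [lam, Finsupp.lmapDomain]

/-- A linear map on `M[λ]` that turns multiplication by `λ` into a given endomorphism is determined
by its values on constants. -/
theorem hom_ext {G H : LPoly M →ₗ[F] N} (T : Module.End F N)
    (hG : ∀ p, G (lam F p) = T (G p)) (hH : ∀ p, H (lam F p) = T (H p))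
    (h : ∀ m, G (const F m) = H (const F m)) (p : LPoly M) : G p = H p := by
  suffices G = H by rw [this]
  apply Finsupp.lhom_ext
  intro n m
  induction n with
  | zero => exact h m
  | succ n ih => rw [← lam_single (F := F), hG, hH, ih]

@[simp] theorem subst_const (f : M →ₗ[F] N) (T : Module.End F N) (m : M) :
    subst f T (const F m) = f m := by
  simp [subst, const]

@[simp] theorem subst_lam (f : M →ₗ[F] N) (T : Module.End F N) (p : LPoly M) :
    subst f T (lam F p) = T (subst f T p) := by
  induction p using Finsupp.induction_linear with
  | zero => simp
  | add p q hp hq => simp [hp, hq]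
  | single n m => simp [lam_single, subst, pow_succ']

@[simp] theorem map_const (f : M →ₗ[F] N) (m : M) : map f (const F m) = const F (f m) := by
  simp [map, const]

@[simp] theorem map_lam (f : M →ₗ[F] N) (p : LPoly M) : map f (lam F p) = lam F (map f p) := by
  induction p using Finsupp.induction_linear with
  | zero => simp
  | add p q hp hq => simp [hp, hq]
  | single n m => simp [lam_single, map]

theorem map_comp (f : N →ₗ[F] P) (g : M →ₗ[F] N) (p : LPoly M) :
    map (f ∘ₗ g) p = map f (map g p) :=
  hom_ext (G := map (f ∘ₗ g)) (H := map f ∘ₗ map g) (lam F) (by simp) (by simp) (by simp) p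

theorem map_map_comm {f : N →ₗ[F] P} {g : M →ₗ[F] N} {N' : Type*} [AddCommGroup N'] [Module F N']
    {f' : N' →ₗ[F] P} {g' : M →ₗ[F] N'} (h : ∀ m, f (g m) = f' (g' m)) (p : LPoly M) :
    map f (map g p) = map f' (map g' p) := by
  rw [← map_comp, ← map_comp]
  congr 1
  congr 1
  exact LinearMap.ext h

theorem lamAdd_apply (d : M →ₗ[F] M) (p : LPoly M) : lamAdd d p = lam F p + map d p := rfl

theorem lamAdd_lam (d : M →ₗ[F] M) (p : LPoly M) :
    lamAdd d (lam F p) = lam F (lamAdd d p) := by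
  simp [lamAdd_apply]

@[simp] theorem adj_const (d : M →ₗ[F] M) (m : M) : adj d (const F m) = const F m :=
  subst_const _ _ _

@[simp] theorem adj_lam (d : M →ₗ[F] M) (p : LPoly M) : adj d (lam F p) = -lamAdd d (adj d p) :=
  subst_lam _ _ _

/-- Naturality of `adj`. -/
theorem adj_map {d : M →ₗ[F] M} {d' : N →ₗ[F] N} {f : M →ₗ[F] N} (h : ∀ m, f (d m) = d' (f m))
    (p : LPoly M) : adj d' (map f p) = map f (adj d p) :=
  hom_ext (G := adj d' ∘ₗ map f) (H := map f ∘ₗ adj d) (-lamAdd d') (by simp)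
    (fun p => by simp [lamAdd_apply, map_map_comm h]) (by simp) p

@[simp] theorem adj_map_self (d : M →ₗ[F] M) (p : LPoly M) : adj d (map d p) = map d (adj d p) :=
  adj_map (fun _ => rfl) p

/-- Putting −λ−∂ for λ in λ+∂ leaves −λ; this is what makes `adj` an involution. -/
theorem adj_lamAdd (d : M →ₗ[F] M) (p : LPoly M) : adj d (lamAdd d p) = -lam F (adj d p) := by
  simp [lamAdd_apply]

@[simp] theorem adj_adj (d : M →ₗ[F] M) (p : LPoly M) : adj d (adj d p) = p :=
  hom_ext (G := adj d ∘ₗ adj d) (H := LinearMap.id) (lam F) (by simp [adj_lamAdd])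
    (by simp) (by simp) p

@[simp] theorem lam₂_apply (p : LPoly (LPoly M)) : lam₂ F M p = lam F p := rfl

@[simp] theorem lam₁_const (p : LPoly M) : lam₁ F M (const F p) = const F (lam F p) :=
  map_const _ _

@[simp] theorem lam₁_lam (p : LPoly (LPoly M)) : lam₁ F M (lam F p) = lam F (lam₁ F M p) :=
  map_lam _ _

theorem map_map_lam₁ (f : M →ₗ[F] N) (p : LPoly (LPoly M)) :
    map (map f) (lam₁ F M p) = lam₁ F N (map (map f) p) :=
  map_map_comm (fun _ => map_lam _ _) p

theorem subst_map (f : N →ₗ[F] P) (T : Module.End F P) (g : M →ₗ[F] N) (p : LPoly M) :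
    subst f T (map g p) = subst (f ∘ₗ g) T p :=
  hom_ext (G := subst f T ∘ₗ map g) (H := subst (f ∘ₗ g) T) T (by simp) (by simp) (by simp) p

variable (F) in
/-- Exchange of the two indeterminates. -/
noncomputable def swap : LPoly (LPoly M) →ₗ[F] LPoly (LPoly M) :=
  subst (map (const F)) (lam₁ F M)

@[simp] theorem swap_const (p : LPoly M) : swap F (const F p) = map (const F) p := subst_const _ _ _

@[simp] theorem swap_lam (p : LPoly (LPoly M)) : swap F (lam F p) = lam₁ F M (swap F p) :=
  subst_lam _ _ _

@[simp] theorem swap_lam₁ (p : LPoly (LPoly M)) : swap F (lam₁ F M p) = lam F (swap F p) :=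
  hom_ext (G := swap F ∘ₗ lam₁ F M) (H := lam F ∘ₗ swap F) (lam₁ F M) (by simp) (by simp) (by simp) p

@[simp] theorem swap_map_const (p : LPoly M) : swap F (map (const F) p) = const F p :=
  hom_ext (G := swap F ∘ₗ map (const F)) (H := const F) (lam₁ F M) (by simp) (by simp)
    (by simp) p

@[simp] theorem swap_swap (p : LPoly (LPoly M)) : swap F (swap F p) = p :=
  hom_ext (G := swap F ∘ₗ (swap F : LPoly (LPoly M) →ₗ[F] _)) (H := LinearMap.id) (lam F) (by simp) (by simp) (by simp) p

variable (F) in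
/-- `p(λ) ↦ p(λ+μ)`. -/
noncomputable def shift : LPoly M →ₗ[F] LPoly (LPoly M) :=
  subst (const₂ F) (lam₁ F M + lam₂ F M)

@[simp] theorem shift_const (m : M) : shift F (const F m) = const F (const F m) := subst_const _ _ _

@[simp] theorem shift_lam (p : LPoly M) :
    shift F (lam F p) = lam₁ F M (shift F p) + lam F (shift F p) := subst_lam _ _ _

theorem swap_shift (p : LPoly M) : swap F (shift F p) = shift F p :=
  hom_ext (G := swap F ∘ₗ shift F) (H := shift F) (lam₁ F M + lam₂ F M) (by simp [add_comm])
    (by simp) (by simp) p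

theorem swap_map_map (i : M →ₗ[F] N) (p : LPoly (LPoly M)) :
    swap F (map (map i) p) = map (map i) (swap F p) :=
  hom_ext (G := swap F ∘ₗ map (map i)) (H := map (map i) ∘ₗ swap F) (lam₁ F N) (by simp)
    (by simp [map_map_lam₁]) (fun p => by
      simp only [LinearMap.comp_apply, map_const, swap_const]
      exact map_map_comm (fun m => (map_const i m).symm) p) p

theorem shift_map (i : M →ₗ[F] N) (p : LPoly M) :
    shift F (map i p) = map (map i) (shift F p) :=
  hom_ext (G := shift F ∘ₗ map i) (H := map (map i) ∘ₗ shift F) (lam₁ F N + lam₂ F N) (by simp)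
    (by simp [map_map_lam₁]) (by simp) p

/-- `p(λ) ↦ p(-μ-∂)`, obtained from `p(λ+μ)`. -/
theorem adj_shift (d : M →ₗ[F] M) (p : LPoly M) :
    adj (lamAdd d) (shift F p) = map (const F) (adj d p) := by
  refine hom_ext (G := adj (lamAdd d) ∘ₗ shift F) (H := map (const F) ∘ₗ adj d)
    (-(lam₂ F M + map (map d))) (fun p => ?_) (fun p => ?_) (by simp) p
  -- Here `adj (lamAdd d)` replaces μ by −μ−λ−∂, so λ+μ becomes −μ−∂. It commutes with
  -- multiplication by λ because `lamAdd d` does.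
  · have h : adj (lamAdd d) (lam₁ F M (shift F p)) = lam₁ F M (adj (lamAdd d) (shift F p)) :=
      adj_map (fun m => (lamAdd_lam d m).symm) _
    have h2 : lamAdd (lamAdd d) (adj (lamAdd d) (shift F p)) = lam F (adj (lamAdd d) (shift F p)) +
        (lam₁ F M (adj (lamAdd d) (shift F p)) + map (map d) (adj (lamAdd d) (shift F p))) := by
      rw [lamAdd_apply]
      congr 1
      generalize adj (lamAdd d) (shift F p) = q
      exact hom_ext (G := map (lamAdd d)) (H := lam₁ F M + map (map d)) (lam F) (by simp)
        (by simp) (by simp [lamAdd_apply]) q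
    simp [h, h2]
    abel
  · simp [lamAdd_apply]
    exact map_map_comm (fun m => (map_const d m).symm) _

end Calculus

/-! ### The Jacobiator and its behaviour under permutations of its arguments. -/

section Jacobiator

variable {F M N : Type*} [Field F] [AddCommGroup M] [Module F M] [AddCommGroup N] [Module F N]

/-- `∑ λ ^ n m_n ↦ ∑ λ ^ n [m_n _{λ+μ} w]`. -/
noncomputable def outer (B : LambdaBracket F M) (w : M) : LPoly M →ₗ[F] LPoly (LPoly M) :=
  subst (shift F ∘ₗ B.flip w) (lam₁ F M)

@[simp] theorem outer_const (B : LambdaBracket F M) (w m : M) :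
    outer B w (const F m) = shift F (B m w) := subst_const _ _ _

@[simp] theorem outer_lam (B : LambdaBracket F M) (w : M) (p : LPoly M) :
    outer B w (lam F p) = lam₁ F M (outer B w p) := subst_lam _ _ _

/-- The difference of the two sides of the Jacobi identity. -/
noncomputable def jacobiator (B : LambdaBracket F M) (u v w : M) : LPoly (LPoly M) :=
  map (B u) (B v w) - swap F (map (B v) (B u w)) - outer B w (B u v)

theorem jacobiator_eq_zero_iff (B : LambdaBracket F M) (u v w : M) :
    jacobiator B u v w = 0 ↔
      map (B u) (B v w) - subst (map (const F : M →ₗ[F] LPoly M) ∘ₗ B v) (lam₁ F M) (B u w)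
        = subst (subst (const₂ F) (lam₁ F M + lam₂ F M) ∘ₗ B.flip w) (lam₁ F M) (B u v) := by
  rw [jacobiator, swap, subst_map, sub_eq_zero]
  rfl

theorem outer_map_der {d : M →ₗ[F] M} {B : LambdaBracket F M}
    (hl : ∀ u v, B (d u) v = -lam F (B u v)) (w : M) (p : LPoly M) :
    outer B w (map d p) = -(lam₁ F M (outer B w p) + lam F (outer B w p)) :=
  hom_ext (G := outer B w ∘ₗ map d) (H := -(lam₁ F M + lam₂ F M) ∘ₗ outer B w) (lam₁ F M)
    (by simp) (fun p => by simp [add_comm]) (by simp [hl, add_comm]) p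

/-- Inside [·_{λ+μ} w] the derivation ∂ acts as −λ−μ, so −λ−∂ becomes μ. -/
theorem outer_adj {d : M →ₗ[F] M} {B : LambdaBracket F M}
    (hl : ∀ u v, B (d u) v = -lam F (B u v)) (w : M) (p : LPoly M) :
    outer B w (adj d p) = swap F (outer B w p) :=
  hom_ext (G := outer B w ∘ₗ adj d) (H := swap F ∘ₗ outer B w) (lam F)
    (fun p => by simp [lamAdd_apply, outer_map_der hl]) (by simp) (by simp [swap_shift]) p

/-- Exchanging λ and μ interchanges the two nested terms; the third changes sign by skewsymmetry and
`outer_adj`. -/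
theorem jacobiator_swap {d : M →ₗ[F] M} {B : LambdaBracket F M}
    (hl : ∀ u v, B (d u) v = -lam F (B u v)) (hs : ∀ u v, B v u = -adj d (B u v)) (u v w : M) :
    jacobiator B v u w = -swap F (jacobiator B u v w) := by
  simp only [jacobiator, map_sub, swap_swap]
  rw [hs u v, map_neg (outer B w), outer_adj hl]
  abel

/-- Under μ ↦ −λ−μ−∂ the bracket [m_{λ+μ} v] becomes [m_{-μ-∂} v], which is −[v_μ m] by
skewsymmetry. -/
theorem adj_outer {d : M →ₗ[F] M} {B : LambdaBracket F M}
    (hs : ∀ u v, B v u = -adj d (B u v)) (v : M) (p : LPoly M) :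
    adj (lamAdd d) (outer B v p) = -swap F (map (B v) p) :=
  hom_ext (G := adj (lamAdd d) ∘ₗ outer B v) (H := -(swap F ∘ₗ map (B v))) (lam₁ F M)
    (fun p => by
      simp only [LinearMap.comp_apply, outer_lam]
      exact adj_map (fun m => (lamAdd_lam d m).symm) _) (by simp)
    (fun m => by
      simp only [LinearMap.comp_apply, outer_const, adj_shift, LinearMap.neg_apply, map_const,
        swap_const, hs m v, map_neg, neg_neg]) p

/-- The substitution is μ ↦ −λ−μ−∂. The first term only changes sign, because [u_λ ·] carries ∂ to
λ+∂ and `adj` is natural; the second and third terms trade places by `adj_outer`. -/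
theorem jacobiator_rotate {d : M →ₗ[F] M} {B : LambdaBracket F M}
    (hr : ∀ u v, B u (d v) = lamAdd d (B u v)) (hs : ∀ u v, B v u = -adj d (B u v)) (u v w : M) :
    jacobiator B u v w = -adj (lamAdd d) (jacobiator B u w v) := by
  have h := congrArg (adj (lamAdd d)) (adj_outer hs w (B u v))
  rw [adj_adj, map_neg] at h
  have h1 : map (B u) (B v w) = -adj (lamAdd d) (map (B u) (B w v)) := by
    rw [adj_map (hr u), hs w v, map_neg]
  simp only [jacobiator, map_sub, adj_outer hs, h, h1]
  abel

theorem outer_map {P : Type*} [AddCommGroup P] [Module F P] {B : LambdaBracket F N} {w : N}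
    {i : M →ₗ[F] N} {j : P →ₗ[F] N} {f : M →ₗ[F] LPoly P} (h : ∀ m, B (i m) w = map j (f m))
    (p : LPoly M) : outer B w (map i p) = map (map j) (subst (shift F ∘ₗ f) (lam₁ F P) p) :=
  hom_ext (G := outer B w ∘ₗ map i) (H := map (map j) ∘ₗ subst (shift F ∘ₗ f) (lam₁ F P))
    (lam₁ F N) (by simp) (by simp [map_map_lam₁]) (by simp [h, shift_map]) p

theorem jacobiator_map {B : LambdaBracket F M} {B' : LambdaBracket F N} {i : M →ₗ[F] N}
    (h : ∀ u v, B' (i u) (i v) = map i (B u v)) (u v w : M) :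
    jacobiator B' (i u) (i v) (i w) = map (map i) (jacobiator B u v w) := by
  have h1 (u v w : M) : map (B' (i u)) (B' (i v) (i w)) = map (map i) (map (B u) (B v w)) := by
    rw [h]
    exact map_map_comm (h u) _
  have h4 (p : LPoly M) : outer B' (i w) (map i p) = map (map i) (outer B w p) :=
    outer_map (f := B.flip w) (fun m => h m w) p
  rw [jacobiator, h1, h1, h, swap_map_map, h4, jacobiator, map_sub, map_sub]

end Jacobiator

/-! ### The operation `arrow` as multiplication conjugated by `adj`. -/

section Arrow

variable {F V : Type*} [Field F] [CommRing V] [Algebra F V]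

theorem smul_const {R M : Type*} [Semiring R] [AddCommGroup M] [Module F M] [Module R M]
    (g : R) (c : M) : g • const F c = const F (g • c) :=
  Finsupp.smul_single g 0 c

theorem smul_lam {R M : Type*} [Semiring R] [AddCommGroup M] [Module F M] [Module R M]
    (g : R) (p : LPoly M) : g • lam F p = lam F (g • p) := by
  induction p using Finsupp.induction_linear with
  | zero => simp
  | add p q hp hq => simp only [map_add, smul_add, hp, hq]
  | single n m => rw [lam_single, Finsupp.smul_single, Finsupp.smul_single, lam_single]

theorem lamAdd_smul (d : Derivation F V V) (c : V) (p : LPoly V) :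
    lamAdd d.toLinearMap (c • p) = c • lamAdd d.toLinearMap p + d c • p := by
  have h : map d.toLinearMap (c • p) = c • map d.toLinearMap p + d c • p := by
    ext n
    simp [map, mul_comm]
  rw [lamAdd_apply, lamAdd_apply, h, smul_add, smul_lam, add_assoc]

/-- `p ↦ p(λ+x)(|_{x = ∂} b)` as a linear map. -/
noncomputable def arrowₗ (d : V →ₗ[F] V) (b : V) : LPoly V →ₗ[F] LPoly V where
  toFun p := arrow d p b
  map_add' p q := by
    unfold arrow
    exact Finsupp.sum_add_index' (by simp) (by simp [add_smul])
  map_smul' c p := by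
    unfold arrow
    rw [Finsupp.sum_smul_index' (by simp)]
    simp [Finsupp.smul_sum]

@[simp] theorem arrowₗ_apply (d : V →ₗ[F] V) (b : V) (p : LPoly V) :
    arrowₗ d b p = arrow d p b := rfl

theorem arrow_single (d : V →ₗ[F] V) (b : V) (n : ℕ) (c : V) :
    arrow d (Finsupp.single n c) b = c • (lamAdd d ^ n) (const F b) := by
  simp [arrow]

theorem arrow_const (d : V →ₗ[F] V) (b c : V) : arrow d (const F c) b = const F (c * b) := by
  rw [← smul_eq_mul, ← smul_const]
  exact (arrow_single d b 0 c).trans (by simp)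

theorem arrow_lamAdd (d : Derivation F V V) (b : V) (p : LPoly V) :
    arrow d.toLinearMap (lamAdd d.toLinearMap p) b
      = lamAdd d.toLinearMap (arrow d.toLinearMap p b) := by
  simp only [← arrowₗ_apply]
  induction p using Finsupp.induction_linear with
  | zero => simp only [map_zero]
  | add p q hp hq => simp only [map_add, hp, hq]
  | single n m =>
    have h : lamAdd d.toLinearMap (Finsupp.single n m)
        = Finsupp.single (n + 1) m + Finsupp.single n (d m) := by
      rw [lamAdd_apply, lam_single]
      simp [map]
    rw [h, map_add]
    simp only [arrowₗ_apply, arrow_single, lamAdd_smul, pow_succ', Module.End.mul_apply]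

/-- This exchange turns the left Leibniz rule into the right one when the arguments of a bracket are
reversed. -/
theorem adj_smul (d : Derivation F V V) (g : V) (p : LPoly V) :
    adj d.toLinearMap (g • p) = arrow d.toLinearMap (adj d.toLinearMap p) g := by
  refine hom_ext (G := adj d.toLinearMap ∘ₗ (LinearMap.lsmul V (LPoly V) g).restrictScalars F)
    (H := arrowₗ d.toLinearMap g ∘ₗ adj d.toLinearMap) (-lamAdd d.toLinearMap)
    (fun p => ?_) (fun p => ?_) (fun c => ?_) p
  · simp [smul_lam]
  · simp [-arrowₗ_apply]
    simp [arrow_lamAdd]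
  · simp [smul_const, arrow_const, mul_comm]

theorem arrow_eq (d : Derivation F V V) (p : LPoly V) (g : V) :
    arrow d.toLinearMap p g = adj d.toLinearMap (g • adj d.toLinearMap p) := by
  rw [adj_smul, adj_adj]

theorem adj_arrow (d : Derivation F V V) (p : LPoly V) (g : V) :
    adj d.toLinearMap (arrow d.toLinearMap p g) = g • adj d.toLinearMap p := by
  rw [arrow_eq, adj_adj]

theorem arrow_smul (d : V →ₗ[F] V) (g : V) (p : LPoly V) (b : V) :
    arrow d (g • p) b = g • arrow d p b := by
  unfold arrow
  rw [Finsupp.sum_smul_index' (by simp), Finsupp.smul_sum]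
  simp [mul_smul]

end Arrow

/-! ### Products q(λ)p(μ) arising from the left Leibniz rule. -/

section Leibniz

variable {F V : Type*} [Field F] [CommRing V] [Algebra F V]

variable (F) in
/-- The product `q(λ) p(μ)`. -/
noncomputable def outerMul (q : LPoly V) : LPoly V →ₗ[F] LPoly (LPoly V) :=
  map ((LinearMap.toSpanSingleton V (LPoly V) q).restrictScalars F)

theorem swap_outerMul (p q : LPoly V) :
    swap F (outerMul F q p) = outerMul F p q := by
  -- The right-hand side as a linear function of p, so that `hom_ext` can compare the two sides.
  let H : LPoly V →ₗ[F] LPoly (LPoly V) :=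
    { toFun := fun p => outerMul F p q
      map_add' := fun p p' => by ext : 1; simp [outerMul, map]
      map_smul' := fun c p => Finsupp.ext fun n => smul_comm (q n) c p }
  refine hom_ext (G := swap F ∘ₗ outerMul F q) (H := H) (lam₁ F V) (fun p => ?_) (fun p => ?_)
    (fun c => ?_) p
  · simp [outerMul]
  · ext : 1
    simp [H, outerMul, lam₁, map, smul_lam]
  · ext : 1
    simp only [H, outerMul, LinearMap.comp_apply, map_const, swap_const, LinearMap.coe_mk,
      AddHom.coe_mk]
    simp [map, smul_const, mul_comm]

theorem map_bracket_smul {B : LambdaBracket F V} (hB : LeftLeibniz B) (f h : V) (p : LPoly V) :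
    map (B f) (h • p) = h • map (B f) p + outerMul F (B f h) p := by
  ext : 1
  simp [map, outerMul, hB f]

theorem swap_smul (h : V) (p : LPoly (LPoly V)) : swap F (h • p) = h • swap F p := by
  have h2 (p : LPoly (LPoly V)) : h • lam₁ F V p = lam₁ F V (h • p) := by
    ext : 1
    simp [lam₁, map, smul_lam]
  refine hom_ext (G := swap F ∘ₗ (LinearMap.lsmul V (LPoly (LPoly V)) h).restrictScalars F)
    (H := (LinearMap.lsmul V (LPoly (LPoly V)) h).restrictScalars F ∘ₗ swap F) (lam₁ F V)
    (by simp [smul_lam]) (by simp [h2]) (fun q => ?_) p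
  simp only [LinearMap.comp_apply, LinearMap.restrictScalars_apply, LinearMap.lsmul_apply, smul_const,
    swap_const]
  ext : 1
  simp [map, smul_const]

end Leibniz

end LPoly

/-! ### Extension of derivations to the symmetric algebra. -/

namespace SymmetricAlgebra

variable {F A E M : Type*} [Field F] [CommRing A] [Algebra F A]
  [AddCommGroup E] [Module F E] [Module A E] [IsScalarTower F A E]
  [AddCommGroup M] [Module F M] [Module (SymmetricAlgebra A E) M]
  [IsScalarTower F (SymmetricAlgebra A E) M]

omit [IsScalarTower F (SymmetricAlgebra A E) M] in
theorem derivation_ext {D D' : Derivation F (SymmetricAlgebra A E) M}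
    (hA : ∀ a : A, D (algebraMap A _ a) = D' (algebraMap A _ a))
    (hE : ∀ u : E, D (ι A E u) = D' (ι A E u)) : D = D' := by
  ext f
  induction f using SymmetricAlgebra.induction with
  | algebraMap a => exact hA a
  | ι u => exact hE u
  | mul f g hf hg => rw [Derivation.leibniz, Derivation.leibniz, hf, hg]
  | add f g hf hg => rw [map_add, map_add, hf, hg]

/-- A derivation of `A` and a compatible linear map on `E` extend to a derivation of `S_A(E)`. -/
theorem exists_derivation (δA : A →ₗ[F] M) (δE : E →ₗ[F] M)
    (hA : ∀ a b, δA (a * b) = algebraMap A (SymmetricAlgebra A E) a • δA b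
      + algebraMap A (SymmetricAlgebra A E) b • δA a)
    (hE : ∀ (a : A) (u : E), δE (a • u) = algebraMap A (SymmetricAlgebra A E) a • δE u
      + ι A E u • δA a) :
    ∃ D : Derivation F (SymmetricAlgebra A E) M,
      (∀ a, D (algebraMap A _ a) = δA a) ∧ ∀ u, D (ι A E u) = δE u := by
  let S := SymmetricAlgebra A E
  -- A derivation into M is an algebra map into the square-zero extension S ⊕ M. Its ring structure
  -- needs a right action on M, here the left one transported by commutativity.
  let _ : Module Sᵐᵒᵖ M := Module.compHom M ((RingHom.id S).fromOpposite mul_comm)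
  have _ : IsCentralScalar S M := ⟨fun _ _ => rfl⟩
  have h1 : δA 1 = 0 := by simpa using hA 1 1
  let i : A →+* TrivSqZeroExt S M :=
    { toFun := fun a => (algebraMap A S a, δA a)
      map_one' := TrivSqZeroExt.ext (map_one _) h1
      map_zero' := TrivSqZeroExt.ext (map_zero _) (map_zero _)
      map_add' := fun a b => TrivSqZeroExt.ext (map_add _ _ _) (map_add _ _ _)
      map_mul' := fun a b => TrivSqZeroExt.ext (map_mul _ _ _) (hA a b) }
  -- A acts through a ↦ a + δA(a), not through the first summand alone; `hE` is A-linearity of u ↦ u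
  -- + δE(u) for this action.
  let _ : Algebra A (TrivSqZeroExt S M) := i.toAlgebra
  let j : E →ₗ[A] TrivSqZeroExt S M :=
    { toFun := fun u => (ι A E u, δE u)
      map_add' := fun u v => TrivSqZeroExt.ext (map_add _ _ _) (map_add _ _ _)
      map_smul' := fun a u => by
        refine Eq.trans ?_ (Algebra.smul_def (A := TrivSqZeroExt S M) a _).symm
        exact TrivSqZeroExt.ext ((map_smul _ _ _).trans (Algebra.smul_def _ _)) (hE a u) }
  have hfst (f : S) : (lift j f).fst = f := by
    induction f using SymmetricAlgebra.induction with
    | algebraMap a => rw [AlgHom.commutes]; rfl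
    | ι u => rw [lift_ι_apply]; rfl
    | mul f g hf hg => rw [map_mul, TrivSqZeroExt.fst_mul, hf, hg]
    | add f g hf hg => rw [map_add, TrivSqZeroExt.fst_add, hf, hg]
  have hmul (f g : S) : (lift j (f * g)).snd = f • (lift j g).snd + g • (lift j f).snd := by
    rw [map_mul, TrivSqZeroExt.snd_mul, hfst, hfst, op_smul_eq_smul]
  have halg (a : A) : (lift j (algebraMap A S a)).snd = δA a := by
    rw [AlgHom.commutes]; rfl
  have hF (c : F) : δA (algebraMap F A c) = 0 := by
    rw [Algebra.algebraMap_eq_smul_one, map_smul, h1, smul_zero]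
  refine ⟨Derivation.mk'
    { toFun := fun f => (lift j f).snd
      map_add' := fun f g => by rw [map_add, TrivSqZeroExt.snd_add]
      map_smul' := fun c f => by
        rw [Algebra.smul_def, hmul, IsScalarTower.algebraMap_apply F A S, halg, hF, smul_zero,
          add_zero, ← IsScalarTower.algebraMap_apply, algebraMap_smul, RingHom.id_apply] }
    hmul, halg, fun u => ?_⟩
  change (lift j (ι A E u)).snd = _
  rw [lift_ι_apply]
  rfl

end SymmetricAlgebra

/-! ### Construction of the bracket on S_A(E). -/

namespace LieConformalAlgebroid

open LPoly SymmetricAlgebra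

variable {F A E : Type*} [Field F] [CommRing A] [Algebra F A] {dA : Derivation F A A}
  [AddCommGroup E] [Module F E] [Module A E] [IsScalarTower F A E]

/-- The inclusion of `A` in `S_A(E)`. -/
noncomputable abbrev inA (F A E : Type*) [Field F] [CommRing A] [Algebra F A]
    [AddCommGroup E] [Module F E] [Module A E] [IsScalarTower F A E] :
    A →ₗ[F] SymmetricAlgebra A E :=
  (Algebra.linearMap A (SymmetricAlgebra A E)).restrictScalars F

/-- The inclusion of `E` in `S_A(E)`. -/
noncomputable abbrev inE (F A E : Type*) [Field F] [CommRing A] [Algebra F A]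
    [AddCommGroup E] [Module F E] [Module A E] [IsScalarTower F A E] :
    E →ₗ[F] SymmetricAlgebra A E :=
  (SymmetricAlgebra.ι A E).restrictScalars F

theorem map_inA_smul (a : A) (p : LPoly A) :
    map (inA F A E) (a • p) = algebraMap A (SymmetricAlgebra A E) a • map (inA F A E) p := by
  ext n
  simp [map, Algebra.smul_def]

theorem map_inE_smul (a : A) (p : LPoly E) :
    map (inE F A E) (a • p) = algebraMap A (SymmetricAlgebra A E) a • map (inE F A E) p := by
  ext n
  simp [map, Algebra.smul_def]

theorem map_inE_smulRight (p : LPoly A) (v : E) :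
    map (inE F A E) (smulRight (F := F) p v) = ι A E v • map (inA F A E) p := by
  ext n
  simp [map, smulRight, Algebra.smul_def, mul_comm]

theorem adj_map_inA (L : LieConformalAlgebroid dA E) (p : LPoly A) :
    adj L.toDiffModule.symDer.toLinearMap (map (inA F A E) p)
      = map (inA F A E) (adj dA.toLinearMap p) :=
  adj_map (fun a => (L.toDiffModule.symDer_algebraMap a).symm) p

theorem adj_map_inE (L : LieConformalAlgebroid dA E) (p : LPoly E) :
    adj L.toDiffModule.symDer.toLinearMap (map (inE F A E) p)
      = map (inE F A E) (adj L.der p) :=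
  adj_map (fun a => (L.toDiffModule.symDer_ι a).symm) p

/-- The extension exists because u ↦ θ(u)^*_λ(a) is A-linear: `adj` turns the twisted action in
`anchor_smul` into plain multiplication. -/
theorem exists_baseDer (L : LieConformalAlgebroid dA E) (a : A) :
    ∃ D : Derivation F (SymmetricAlgebra A E) (LPoly (SymmetricAlgebra A E)),
      (∀ b, D (algebraMap A _ b) = 0) ∧
      ∀ u, D (ι A E u) = -map (inA F A E) (adj dA.toLinearMap ((L.anchor u).1 a)) := by
  refine exists_derivation 0
    (-(map (inA F A E) ∘ₗ adj dA.toLinearMap ∘ₗ ((CDer dA).subtype ∘ₗ L.anchor).flip a))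
    (by simp) (fun b u => ?_)
  have h : adj dA.toLinearMap ((L.anchor (b • u)).1 a)
      = b • adj dA.toLinearMap ((L.anchor u).1 a) := by
    rw [L.anchor_smul, adj_arrow]
  change -map (inA F A E) (adj dA.toLinearMap ((L.anchor (b • u)).1 a))
    = algebraMap A (SymmetricAlgebra A E) b •
      -map (inA F A E) (adj dA.toLinearMap ((L.anchor u).1 a)) + ι A E u • 0
  rw [h, map_inA_smul, smul_zero, add_zero, smul_neg]

/-- The two compatibility conditions are the Leibniz rule for θ(u) and the axiom `bracket_smul`. -/
theorem exists_moduleDer (L : LieConformalAlgebroid dA E) (u : E) :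
    ∃ D : Derivation F (SymmetricAlgebra A E) (LPoly (SymmetricAlgebra A E)),
      (∀ b, D (algebraMap A _ b) = map (inA F A E) ((L.anchor u).1 b)) ∧
      ∀ v, D (ι A E v) = map (inE F A E) (L.bracket u v) := by
  refine exists_derivation (map (inA F A E) ∘ₗ (L.anchor u).1)
    (map (inE F A E) ∘ₗ L.bracket u) (fun a b => ?_) (fun b v => ?_)
  · simp only [LinearMap.comp_apply, (L.anchor u).2.2, map_add, map_inA_smul]
    exact add_comm _ _
  · simp only [LinearMap.comp_apply, L.bracket_smul, map_add, map_inE_smul, map_inE_smulRight]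
    exact add_comm _ _

/-- The derivation `{a_λ ·}` of `S_A(E)` for `a ∈ A`. -/
noncomputable def baseDer (L : LieConformalAlgebroid dA E) (a : A) :
    Derivation F (SymmetricAlgebra A E) (LPoly (SymmetricAlgebra A E)) :=
  (L.exists_baseDer a).choose

/-- The derivation `{u_λ ·}` of `S_A(E)` for `u ∈ E`. -/
noncomputable def moduleDer (L : LieConformalAlgebroid dA E) (u : E) :
    Derivation F (SymmetricAlgebra A E) (LPoly (SymmetricAlgebra A E)) :=
  (L.exists_moduleDer u).choose

@[simp] theorem baseDer_algebraMap (L : LieConformalAlgebroid dA E) (a b : A) :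
    L.baseDer a (algebraMap A _ b) = 0 := (L.exists_baseDer a).choose_spec.1 b

@[simp] theorem baseDer_ι (L : LieConformalAlgebroid dA E) (a : A) (u : E) :
    L.baseDer a (ι A E u) = -map (inA F A E) (adj dA.toLinearMap ((L.anchor u).1 a)) :=
  (L.exists_baseDer a).choose_spec.2 u

@[simp] theorem moduleDer_algebraMap (L : LieConformalAlgebroid dA E) (u : E) (b : A) :
    L.moduleDer u (algebraMap A _ b) = map (inA F A E) ((L.anchor u).1 b) :=
  (L.exists_moduleDer u).choose_spec.1 b

@[simp] theorem moduleDer_ι (L : LieConformalAlgebroid dA E) (u v : E) :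
    L.moduleDer u (ι A E v) = map (inE F A E) (L.bracket u v) :=
  (L.exists_moduleDer u).choose_spec.2 v

/-- The compatibility on A needed to extend a ↦ {a_{-λ-∂} ·} to a derivation in the first argument.
-/
theorem baseDer_mul (L : LieConformalAlgebroid dA E) (a b : A) (g : SymmetricAlgebra A E) :
    adj L.toDiffModule.symDer.toLinearMap (L.baseDer (a * b) g)
      = algebraMap A (SymmetricAlgebra A E) a • adj L.toDiffModule.symDer.toLinearMap (L.baseDer b g)
        + algebraMap A (SymmetricAlgebra A E) b • adj L.toDiffModule.symDer.toLinearMap (L.baseDer a g) := by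
  -- With `adj` removed, both sides obey the left Leibniz rule in g, so generators suffice.
  simp only [← adj_arrow, ← map_add]
  congr 1
  induction g using SymmetricAlgebra.induction with
  | algebraMap c => simp only [baseDer_algebraMap, ← arrowₗ_apply, map_zero, add_zero]
  | ι u =>
    simp only [baseDer_ι, arrow_eq, (L.anchor u).2.2, map_neg, map_add, smul_neg, adj_map_inA,
      adj_adj, ← map_inA_smul]
    abel
  | mul g h hg hh =>
    simp only [Derivation.leibniz, hg, hh]
    simp only [← arrowₗ_apply, map_add]
    simp only [arrowₗ_apply, arrow_smul, smul_add]
    abel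
  | add g h hg hh =>
    simp only [map_add, hg, hh, ← arrowₗ_apply]
    abel

/-- The matching compatibility on E: against A it is `anchor_smul`, against E it is `bracket_smul`
read through the skewsymmetry of E. -/
theorem moduleDer_smul (L : LieConformalAlgebroid dA E) (a : A) (u : E)
    (g : SymmetricAlgebra A E) :
    adj L.toDiffModule.symDer.toLinearMap (L.moduleDer (a • u) g)
      = algebraMap A (SymmetricAlgebra A E) a • adj L.toDiffModule.symDer.toLinearMap (L.moduleDer u g)
        + ι A E u • adj L.toDiffModule.symDer.toLinearMap (L.baseDer a g) := by
  induction g using SymmetricAlgebra.induction with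
  | algebraMap c =>
    simp only [moduleDer_algebraMap, baseDer_algebraMap, map_zero, smul_zero, add_zero,
      adj_map_inA, L.anchor_smul, adj_arrow, map_inA_smul]
  | ι v =>
    have h (u v : E) : L.bracket v u = -adj L.der (L.bracket u v) := L.isLieConformal.skew u v
    simp only [moduleDer_ι, baseDer_ι, map_neg, adj_map_inE, adj_map_inA, adj_adj]
    rw [← neg_eq_iff_eq_neg.mpr (h (a • u) v), ← neg_eq_iff_eq_neg.mpr (h u v), L.bracket_smul]
    simp only [map_neg, map_add, map_inE_smul, map_inE_smulRight, smul_neg, neg_add]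
    abel
  | mul g h hg hh =>
    -- Composed with `adj`, a derivation obeys a Leibniz rule twisted by `arrow`, which is linear
    -- over multiplication of its polynomial.
    have key (D : Derivation F (SymmetricAlgebra A E) (LPoly (SymmetricAlgebra A E))) :
      adj L.toDiffModule.symDer.toLinearMap (D (g * h))
        = arrow L.toDiffModule.symDer.toLinearMap
            (adj L.toDiffModule.symDer.toLinearMap (D h)) g
          + arrow L.toDiffModule.symDer.toLinearMap
            (adj L.toDiffModule.symDer.toLinearMap (D g)) h := by
      rw [Derivation.leibniz, map_add, adj_smul, adj_smul]
    simp only [key, hg, hh]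
    simp only [← arrowₗ_apply, map_add]
    simp only [arrowₗ_apply, arrow_smul, smul_add]
    abel
  | add g h hg hh =>
    simp only [map_add, hg, hh, smul_add]
    abel

/-- The map `f ↦ (g ↦ {f_{-λ-∂} g})` as a derivation. -/
theorem exists_adjBracket (L : LieConformalAlgebroid dA E) :
    ∃ Φ : Derivation F (SymmetricAlgebra A E)
        (SymmetricAlgebra A E →ₗ[F] LPoly (SymmetricAlgebra A E)),
      (∀ a g, Φ (algebraMap A _ a) g
        = adj L.toDiffModule.symDer.toLinearMap (L.baseDer a g)) ∧
      ∀ u g, Φ (ι A E u) g = adj L.toDiffModule.symDer.toLinearMap (L.moduleDer u g) := by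
  let δA : A →ₗ[F] SymmetricAlgebra A E →ₗ[F] LPoly (SymmetricAlgebra A E) :=
    { toFun := fun a => adj L.toDiffModule.symDer.toLinearMap ∘ₗ (L.baseDer a).toLinearMap
      map_add' := fun a b => by
        have h : L.baseDer (a + b) = L.baseDer a + L.baseDer b :=
          derivation_ext (by simp) (fun u => by simp [add_comm])
        ext1 g
        simp [h]
      map_smul' := fun c a => by
        have h : L.baseDer (c • a) = c • L.baseDer a :=
          derivation_ext (by simp) (fun u => by simp)
        ext1 g
        simp [h] }
  let δE : E →ₗ[F] SymmetricAlgebra A E →ₗ[F] LPoly (SymmetricAlgebra A E) :=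
    { toFun := fun u => adj L.toDiffModule.symDer.toLinearMap ∘ₗ (L.moduleDer u).toLinearMap
      map_add' := fun u v => by
        have h : L.moduleDer (u + v) = L.moduleDer u + L.moduleDer v :=
          derivation_ext (fun a => by simp) (fun u => by simp)
        ext1 g
        simp [h]
      map_smul' := fun c u => by
        have h : L.moduleDer (c • u) = c • L.moduleDer u :=
          derivation_ext (fun a => by simp) (fun u => by simp)
        ext1 g
        simp [h] }
  -- The coefficient module is Hom(S, S[λ]), with S multiplying the values.
  obtain ⟨Φ, h1, h2⟩ := exists_derivation
    (M := SymmetricAlgebra A E →ₗ[F] LPoly (SymmetricAlgebra A E)) δA δE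
    (fun a b => LinearMap.ext fun g => L.baseDer_mul a b g)
    (fun a u => LinearMap.ext fun g => L.moduleDer_smul a u g)
  exact ⟨Φ, fun a g => by rw [h1]; rfl, fun u g => by rw [h2]; rfl⟩

theorem exists_bracket (L : LieConformalAlgebroid dA E) :
    ∃ B : LambdaBracket F (SymmetricAlgebra A E), LeftLeibniz B ∧
      RightLeibniz L.toDiffModule.symDer B ∧ L.ExtendsTo B := by
  obtain ⟨Φ, hA, hE⟩ := L.exists_adjBracket
  -- Applying the involution `adj` to {f_{-λ-∂} g} recovers {f_λ g}.
  let B : LambdaBracket F (SymmetricAlgebra A E) :=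
    LinearMap.llcomp F _ _ _ (adj L.toDiffModule.symDer.toLinearMap) ∘ₗ Φ.toLinearMap
  have hB (f g) : B f g = adj L.toDiffModule.symDer.toLinearMap (Φ f g) := rfl
  have hBA (a g) : B (algebraMap A _ a) g = L.baseDer a g := by rw [hB, hA, adj_adj]
  have hBE (u g) : B (ι A E u) g = L.moduleDer u g := by rw [hB, hE, adj_adj]
  have hr : RightLeibniz L.toDiffModule.symDer B := by
    intro f g h
    simp only [hB, Derivation.leibniz, LinearMap.add_apply, LinearMap.smul_apply, map_add,
      adj_smul]
    exact add_comm _ _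
  refine ⟨B, fun f g h => ?_, hr, ?_⟩
  · induction f using SymmetricAlgebra.induction with
    | algebraMap a => simp only [hBA, Derivation.leibniz]
    | ι u => simp only [hBE, Derivation.leibniz]
    | mul f f' hf hf' =>
      simp only [hr f f', hf, hf', ← arrowₗ_apply, map_add]
      simp only [arrowₗ_apply, arrow_smul, smul_add]
      abel
    | add f f' hf hf' =>
      simp only [map_add, LinearMap.add_apply, hf, hf', smul_add]
      abel
  · constructor
    · intro a b; rw [hBA, baseDer_algebraMap]
    · intro u a; rw [hBE, moduleDer_algebraMap]
    · intro a u; rw [hBA, baseDer_ι]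
    · intro u v; rw [hBE, moduleDer_ι]

/-! ### Uniqueness, skewsymmetry and sesquilinearity. -/

theorem bracket_ext (L : LieConformalAlgebroid dA E)
    {B B' : LambdaBracket F (SymmetricAlgebra A E)}
    (hl : LeftLeibniz B) (hr : RightLeibniz L.toDiffModule.symDer B) (h : L.ExtendsTo B)
    (hl' : LeftLeibniz B') (hr' : RightLeibniz L.toDiffModule.symDer B') (h' : L.ExtendsTo B') :
    B' = B := by
  have h1 (a : A) (g) : B' (algebraMap A _ a) g = B (algebraMap A _ a) g := by
    induction g using SymmetricAlgebra.induction with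
    | algebraMap b => rw [h.base_base, h'.base_base]
    | ι u => rw [h.base_module, h'.base_module]
    | mul f g hf hg => rw [hl, hl', hf, hg]
    | add f g hf hg => rw [map_add, map_add, hf, hg]
  have h2 (u : E) (g) : B' (ι A E u) g = B (ι A E u) g := by
    induction g using SymmetricAlgebra.induction with
    | algebraMap b => rw [h.module_base, h'.module_base]
    | ι u => rw [h.module_module, h'.module_module]
    | mul f g hf hg => rw [hl, hl', hf, hg]
    | add f g hf hg => rw [map_add, map_add, hf, hg]
  refine LinearMap.ext₂ fun f g => ?_
  induction f using SymmetricAlgebra.induction with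
  | algebraMap a => exact h1 a g
  | ι u => exact h2 u g
  | mul f f' hf hf' => rw [hr, hr', hf, hf']
  | add f f' hf hf' => simp only [map_add, LinearMap.add_apply, hf, hf']

/-- The opposite bracket satisfies the same characterization, since `adj` exchanges the two Leibniz
rules; `bracket_ext` then identifies it with B. -/
theorem bracket_skew (L : LieConformalAlgebroid dA E)
    {B : LambdaBracket F (SymmetricAlgebra A E)}
    (hl : LeftLeibniz B) (hr : RightLeibniz L.toDiffModule.symDer B) (h : L.ExtendsTo B)
    (f g : SymmetricAlgebra A E) :
    B g f = -adj L.toDiffModule.symDer.toLinearMap (B f g) := by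
  let B' : LambdaBracket F (SymmetricAlgebra A E) :=
    (LinearMap.llcomp F _ _ _ (-adj L.toDiffModule.symDer.toLinearMap) ∘ₗ B).flip
  have hB (f g) : B' g f = -adj L.toDiffModule.symDer.toLinearMap (B f g) := rfl
  rw [← hB]
  suffices B' = B by rw [this]
  refine L.bracket_ext hl hr h (fun f g h => ?_) (fun f g h => ?_) ?_
  · simp only [hB, hr g h, map_add, adj_arrow, smul_neg]
    abel
  · simp only [hB, hl h, map_add, adj_smul, ← arrowₗ_apply, map_neg]
    abel
  · constructor
    · intro a b
      rw [hB, h.base_base, map_zero, neg_zero]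
    · intro u a
      rw [hB, h.base_module, map_neg, adj_map_inA, adj_adj, neg_neg]
    · intro a u
      rw [hB, h.module_base, adj_map_inA]
    · intro u v
      rw [hB, h.module_module, adj_map_inE, L.isLieConformal.skew v u, map_neg]

/-- Both Leibniz rules are compatible with λ+∂ (`lamAdd_smul`, `arrow_lamAdd`), which leaves only
pairs of generators. -/
theorem bracket_der (L : LieConformalAlgebroid dA E)
    {B : LambdaBracket F (SymmetricAlgebra A E)}
    (hl : LeftLeibniz B) (hr : RightLeibniz L.toDiffModule.symDer B) (h : L.ExtendsTo B)
    (f g : SymmetricAlgebra A E) :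
    B f (L.toDiffModule.symDer g) = lamAdd L.toDiffModule.symDer.toLinearMap (B f g) := by
  have hA (p : LPoly A) : lamAdd L.toDiffModule.symDer.toLinearMap (map (inA F A E) p)
      = map (inA F A E) (lamAdd dA.toLinearMap p) := by
    rw [lamAdd_apply, lamAdd_apply, map_add, map_lam]
    congr 1
    exact map_map_comm (fun a => L.toDiffModule.symDer_algebraMap a) p
  have hE (p : LPoly E) : lamAdd L.toDiffModule.symDer.toLinearMap (map (inE F A E) p)
      = map (inE F A E) (lamAdd L.der p) := by
    rw [lamAdd_apply, lamAdd_apply, map_add, map_lam]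
    congr 1
    exact map_map_comm (fun a => L.toDiffModule.symDer_ι a) p
  induction f using SymmetricAlgebra.induction with
  | mul f f' hf hf' =>
    rw [hr, hr, hf, hf', map_add, arrow_lamAdd, arrow_lamAdd]
  | add f f' hf hf' =>
    simp only [map_add, LinearMap.add_apply, hf, hf']
  | algebraMap a =>
    induction g using SymmetricAlgebra.induction with
    | algebraMap b => rw [DiffModule.symDer_algebraMap, h.base_base, h.base_base, map_zero]
    | ι u =>
      -- The factor −λ from θ(∂u) becomes λ+∂ under `adj`.
      rw [DiffModule.symDer_ι, h.base_module, h.base_module, L.anchor_der, map_neg, map_neg,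
        adj_lam, map_neg, neg_neg, map_neg, hA]
    | mul g g' hg hg' =>
      simp only [Derivation.leibniz, smul_eq_mul, map_add, hl _ _ _, hg, hg', lamAdd_smul]
      abel
    | add g g' hg hg' => simp only [map_add, hg, hg']
  | ι v =>
    induction g using SymmetricAlgebra.induction with
    | algebraMap b =>
      rw [DiffModule.symDer_algebraMap, h.module_base, h.module_base, (L.anchor v).2.1, hA]
    | ι u =>
      rw [DiffModule.symDer_ι, h.module_module, h.module_module, L.isLieConformal.sesq_right, hE]
    | mul g g' hg hg' =>
      simp only [Derivation.leibniz, smul_eq_mul, map_add, hl _ _ _, hg, hg', lamAdd_smul]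
      abel
    | add g g' hg hg' => simp only [map_add, hg, hg']

end LieConformalAlgebroid

/-! ### The Jacobiator as a derivation in its last argument, and the anchor identity in Jacobi form.
-/

namespace LPoly

variable {F V : Type*} [Field F] [CommRing V] [Algebra F V]

theorem lam₁_smul (h : V) (p : LPoly (LPoly V)) : lam₁ F V (h • p) = h • lam₁ F V p := by
  ext : 1
  simp [lam₁, map, smul_lam]

theorem shift_smul (h : V) (p : LPoly V) : shift F (h • p) = h • shift F p :=
  hom_ext (G := shift F ∘ₗ (LinearMap.lsmul V (LPoly V) h).restrictScalars F)
    (H := (LinearMap.lsmul V (LPoly (LPoly V)) h).restrictScalars F ∘ₗ shift F)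
    (lam₁ F V + lam₂ F V) (fun p => by simp [smul_lam])
    (fun p => by simp [smul_lam, lam₁_smul]) (fun c => by simp [smul_const]) p

theorem outer_mul {B : LambdaBracket F V} (hB : LeftLeibniz B) (g h : V) (p : LPoly V) :
    outer B (g * h) p = g • outer B h p + h • outer B g p :=
  hom_ext (G := outer B (g * h))
    (H := (LinearMap.lsmul V (LPoly (LPoly V)) g).restrictScalars F ∘ₗ outer B h
      + (LinearMap.lsmul V (LPoly (LPoly V)) h).restrictScalars F ∘ₗ outer B g)
    (lam₁ F V) (by simp) (fun p => by simp [lam₁_smul])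
    (fun f => by simp [hB f g h, shift_smul]) p

/-- The nested terms each produce the cross terms {f_λ h}{g_μ k} + {f_λ k}{g_μ h}, which cancel by
`swap_outerMul`; the third term produces none. -/
theorem jacobiator_mul {B : LambdaBracket F V} (hB : LeftLeibniz B) (f g h k : V) :
    jacobiator B f g (h * k) = h • jacobiator B f g k + k • jacobiator B f g h := by
  simp only [jacobiator, hB f h k, hB g h k, map_add, map_bracket_smul hB, swap_smul, outer_mul hB,
    swap_outerMul, smul_sub]
  abel

theorem jacobiator_add {M : Type*} [AddCommGroup M] [Module F M] (B : LambdaBracket F M)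
    (f g h k : M) : jacobiator B f g (h + k) = jacobiator B f g h + jacobiator B f g k := by
  have h1 (p : LPoly M) : outer B (h + k) p = outer B h p + outer B k p :=
    hom_ext (G := outer B (h + k)) (H := outer B h + outer B k) (lam₁ F M) (by simp) (by simp)
      (by simp) p
  simp only [jacobiator, map_add, h1]
  abel

/-- The anchor identity after the substitution `(λ, μ) ↦ (λ, λ+μ)`. -/
theorem map_sub_swap_eq {M N : Type*} [AddCommGroup M] [Module F M] [AddCommGroup N] [Module F N]
    {q : LPoly M} {f : M →ₗ[F] LPoly N} {g h : N →ₗ[F] LPoly N} {r s : LPoly N}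
    (H : subst (map (const F : N →ₗ[F] LPoly N) ∘ₗ f) (lam₁ F N) q
      = subst (const F ∘ₗ g) (lam₂ F N - lam₁ F N) r
        - subst (subst (const₂ F) (lam₂ F N - lam₁ F N) ∘ₗ h) (lam₁ F N) s) :
    map g r - swap F (map h s) = subst (shift F ∘ₗ f) (lam₁ F N) q := by
  -- T substitutes λ+μ for μ, so μ−λ becomes μ; `e2`, `e4` and `e5` are the images of the three
  -- terms of H.
  let T : LPoly (LPoly N) →ₗ[F] LPoly (LPoly N) := subst (const F) (lam₁ F N + lam₂ F N)
  have hT0 (p) : T (const F p) = const F p := subst_const _ _ _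
  have hT2 (p) : T (lam F p) = lam₁ F N (T p) + lam F (T p) := subst_lam _ _ _
  have hT1 (p) : T (lam₁ F N p) = lam₁ F N (T p) :=
    hom_ext (G := T ∘ₗ lam₁ F N) (H := lam₁ F N ∘ₗ T) (lam₁ F N + lam₂ F N) (by simp [hT2])
      (by simp [hT2]) (by simp [hT0]) p
  have e1 (p) : T (map (const F) p) = shift F p :=
    hom_ext (G := T ∘ₗ map (const F)) (H := shift F) (lam₁ F N + lam₂ F N) (by simp [hT2])
      (by simp) (by simp [hT0]) p
  have e2 : T (subst (const F ∘ₗ g) (lam₂ F N - lam₁ F N) r) = map g r :=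
    hom_ext (G := T ∘ₗ subst (const F ∘ₗ g) (lam₂ F N - lam₁ F N)) (H := map g) (lam F)
      (by simp [hT2, hT1]) (by simp) (by simp [hT0]) r
  have e3 (p) : T (subst (const₂ F) (lam₂ F N - lam₁ F N) p) = map (const F) p :=
    hom_ext (G := T ∘ₗ subst (const₂ F) (lam₂ F N - lam₁ F N)) (H := map (const F)) (lam F)
      (by simp [hT2, hT1]) (by simp) (by simp [hT0, const₂]) p
  have e4 : T (subst (subst (const₂ F) (lam₂ F N - lam₁ F N) ∘ₗ h) (lam₁ F N) s)
      = swap F (map h s) :=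
    hom_ext (G := T ∘ₗ subst (subst (const₂ F) (lam₂ F N - lam₁ F N) ∘ₗ h) (lam₁ F N))
      (H := swap F ∘ₗ map h) (lam₁ F N)
      (by simp [hT1]) (by simp) (by simp [e3]) s
  have e5 : T (subst (map (const F : N →ₗ[F] LPoly N) ∘ₗ f) (lam₁ F N) q)
      = subst (shift F ∘ₗ f) (lam₁ F N) q :=
    hom_ext (G := T ∘ₗ subst (map (const F : N →ₗ[F] LPoly N) ∘ₗ f) (lam₁ F N))
      (H := subst (shift F ∘ₗ f) (lam₁ F N)) (lam₁ F N) (by simp [hT1]) (by simp) (by simp [e1]) q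
  rw [← e2, ← e4, ← e5, H, map_sub]

end LPoly

/-! ### The Jacobi identity on generators and on S_A(E). -/

namespace LieConformalAlgebroid

open LPoly SymmetricAlgebra

variable {F A E : Type*} [Field F] [CommRing A] [Algebra F A] {dA : Derivation F A A}
  [AddCommGroup E] [Module F E] [Module A E] [IsScalarTower F A E]

/-- Brackets of A with E have coefficients in A, and brackets within A vanish, so every term is zero
on generators. -/
theorem jacobiator_base_base (L : LieConformalAlgebroid dA E)
    {B : LambdaBracket F (SymmetricAlgebra A E)} (hl : LeftLeibniz B) (h : L.ExtendsTo B)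
    (a b : A) (f : SymmetricAlgebra A E) :
    jacobiator B (algebraMap A _ a) (algebraMap A _ b) f = 0 := by
  have h0 (a : A) (p : LPoly A) : map (B (algebraMap A _ a)) (map (inA F A E) p) = 0 := by
    rw [← map_comp]
    ext n
    simp [map, h.base_base]
  induction f using SymmetricAlgebra.induction with
  | algebraMap c => simp [jacobiator, h.base_base]
  | ι u =>
    simp only [jacobiator, h.base_base, h.base_module, map_neg, map_zero, h0, neg_zero, sub_zero]
  | mul f g hf hg => rw [jacobiator_mul hl, hf, hg, smul_zero, smul_zero, add_zero]
  | add f g hf hg => rw [jacobiator_add, hf, hg, add_zero]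

/-- On A this is the anchor identity, on E the Jacobi identity of E. -/
theorem jacobiator_module_module (L : LieConformalAlgebroid dA E)
    {B : LambdaBracket F (SymmetricAlgebra A E)} (hl : LeftLeibniz B) (h : L.ExtendsTo B)
    (u v : E) (f : SymmetricAlgebra A E) :
    jacobiator B (ι A E u) (ι A E v) f = 0 := by
  induction f using SymmetricAlgebra.induction with
  | algebraMap a =>
    have h1 (u v : E) : map (B (ι A E u)) (map (inA F A E) ((L.anchor v).1 a))
        = map (map (inA F A E)) (map (L.anchor u).1 ((L.anchor v).1 a)) :=
      map_map_comm (h.module_base u) _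
    have h2 := map_sub_swap_eq (L.anchor_bracket u v a)
    have h3 (p : LPoly E) : outer B (algebraMap A _ a) (map (inE F A E) p)
        = map (map (inA F A E)) (subst (shift F ∘ₗ ((CDer dA).subtype ∘ₗ L.anchor).flip a)
          (lam₁ F A) p) :=
      outer_map (fun w => h.module_base w a) p
    rw [jacobiator, h.module_base, h.module_base, h1, h1, h.module_module, h3, ← h2, map_sub,
      swap_map_map, sub_self]
  | ι w =>
    have h1 := jacobiator_map (i := inE F A E) h.module_module u v w
    rw [(jacobiator_eq_zero_iff _ _ _ _).2 (L.isLieConformal.jacobi u v w), map_zero] at h1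
    exact h1
  | mul f g hf hg => rw [jacobiator_mul hl, hf, hg, smul_zero, smul_zero, add_zero]
  | add f g hf hg => rw [jacobiator_add, hf, hg, add_zero]

theorem bracket_der_left (L : LieConformalAlgebroid dA E)
    {B : LambdaBracket F (SymmetricAlgebra A E)}
    (hl : LeftLeibniz B) (hr : RightLeibniz L.toDiffModule.symDer B) (h : L.ExtendsTo B)
    (f g : SymmetricAlgebra A E) : B (L.toDiffModule.symDer f) g = -lam F (B f g) := by
  have hs := L.bracket_skew hl hr h
  rw [hs g (L.toDiffModule.symDer f), L.bracket_der hl hr h, adj_lamAdd, hs g f, map_neg]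

/-- The Jacobi identity extends from generators to `S_A(E)`. -/
theorem jacobiator_eq_zero (L : LieConformalAlgebroid dA E)
    {B : LambdaBracket F (SymmetricAlgebra A E)} (hl : LeftLeibniz B)
    (hr : RightLeibniz L.toDiffModule.symDer B) (h : L.ExtendsTo B)
    (f g k : SymmetricAlgebra A E) : jacobiator B f g k = 0 := by
  have hs := L.bracket_skew hl hr h
  have hd := L.bracket_der hl hr h
  have hdl := L.bracket_der_left hl hr h
  have swap0 {f g k} (H : jacobiator B f g k = 0) : jacobiator B g f k = 0 := by
    rw [jacobiator_swap hdl hs, H, map_zero, neg_zero]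
  have rot0 {f g k} (H : jacobiator B f g k = 0) : jacobiator B f k g = 0 := by
    rw [jacobiator_rotate hd hs, H, map_zero, neg_zero]
  have mul0 {f g k k'} (H : jacobiator B f g k = 0) (H' : jacobiator B f g k' = 0) :
      jacobiator B f g (k * k') = 0 := by
    rw [jacobiator_mul hl, H, H', smul_zero, smul_zero, add_zero]
  have add0 {f g k k'} (H : jacobiator B f g k = 0) (H' : jacobiator B f g k' = 0) :
      jacobiator B f g (k + k') = 0 := by
    rw [jacobiator_add, H, H', add_zero]
  -- Any three generators include two from A or two from E, so up to permutation these two families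
  -- cover all cases.
  have hAA (a b : A) (k) := L.jacobiator_base_base hl h a b k
  have hEE (u v : E) (k) := L.jacobiator_module_module hl h u v k
  have hA (a : A) (g k) : jacobiator B (algebraMap A _ a) g k = 0 := by
    induction g using SymmetricAlgebra.induction with
    | algebraMap b => exact hAA a b k
    | ι u =>
      induction k using SymmetricAlgebra.induction with
      | algebraMap b => exact rot0 (hAA a b _)
      | ι v => exact swap0 (rot0 (hEE u v _))
      | mul k k' hk hk' => exact mul0 hk hk'
      | add k k' hk hk' => exact add0 hk hk'
    -- Products are split only in the third slot: the argument is moved there, split, and moved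
    -- back.
    | mul g g' hg hg' => exact rot0 (mul0 (rot0 hg) (rot0 hg'))
    | add g g' hg hg' => exact rot0 (add0 (rot0 hg) (rot0 hg'))
  have hE (u : E) (g k) : jacobiator B (ι A E u) g k = 0 := by
    induction g using SymmetricAlgebra.induction with
    | algebraMap b => exact swap0 (hA b _ k)
    | ι v => exact hEE u v k
    | mul g g' hg hg' => exact rot0 (mul0 (rot0 hg) (rot0 hg'))
    | add g g' hg hg' => exact rot0 (add0 (rot0 hg) (rot0 hg'))
  induction f using SymmetricAlgebra.induction with
  | algebraMap a => exact hA a g k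
  | ι u => exact hE u g k
  | mul f f' hf hf' => exact swap0 (rot0 (mul0 (rot0 (swap0 hf)) (rot0 (swap0 hf'))))
  | add f f' hf hf' => exact swap0 (rot0 (add0 (rot0 (swap0 hf)) (rot0 (swap0 hf'))))

end LieConformalAlgebroid

theorem mainTheorem7 {F A E : Type*} [Field F] [CharZero F] [CommRing A] [Algebra F A]
    (dA : Derivation F A A) [AddCommGroup E] [Module F E] [Module A E] [IsScalarTower F A E]
    (L : LieConformalAlgebroid dA E) :
    ∃ B : LambdaBracket F (SymmetricAlgebra A E),
      IsPoissonVertexAlgebra L.toDiffModule.symDer B ∧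
      RightLeibniz L.toDiffModule.symDer B ∧
      L.ExtendsTo B ∧
      ∀ B' : LambdaBracket F (SymmetricAlgebra A E),
        LeftLeibniz B' → RightLeibniz L.toDiffModule.symDer B' → L.ExtendsTo B' → B' = B := by
  obtain ⟨B, hl, hr, h⟩ := L.exists_bracket
  refine ⟨B, ⟨⟨L.bracket_der_left hl hr h, L.bracket_der hl hr h, L.bracket_skew hl hr h,
    fun f g k => (LPoly.jacobiator_eq_zero_iff B f g k).1 (L.jacobiator_eq_zero hl hr h f g k)⟩,
    hl⟩, hr, h, fun B' hl' hr' h' => L.bracket_ext hl hr h hl' hr' h'⟩
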